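/- A vertex operator algebra (VOA) is a complex vector space $V=\bigoplus_{n\in\mathbb Z}V_n$ with all $V_n$ finite dimensional and $V_n=0$ for $n\ll 0$, together with vectors $\mathbf 1\in V_0$ (vacuum) and $\omega\in V_2$ (Virasoro element) and a linear injection $v\mapsto Y(v,z)=\sum_{n\in\mathbb Z}v_nz^{-n-1}\in(\operatorname{End}V)[[z,z^{-1}]]$ such that, for all $u,v\in V$: $u_nv=0$ for $n$ sufficiently large; $Y(\mathbf 1,z)=\mathrm{id}_V$; $Y(v,z)\mathbf 1\in V[[z]]$ with constant term $v$; the operators $L(n)=\omega_{n+1}$ satisfy $[L(m),L(n)]=(m-n)L(m+n)+\delta_{m+n,0}\frac{m^3-m}{12}c$ for some $c\in\mathbb Q$; $L(0)$ acts on $V_n$ as multiplication by $n$; $\frac{d}{dz}Y(v,z)=Y(L(-1)v,z)$; and the Jacobi identity $$z_0^{-1}\delta\!\left(\tfrac{z_1-z_2}{z_0}\right)Y(u,z_1)Y(v,z_2)-z_0^{-1}\delta\!\left(\tfrac{z_2-z_1}{-z_0}\right)Y(v,z_2)Y(u,z_1)=z_2^{-1}\delta\!\left(\tfrac{z_1-z_0}{z_2}\right)Y(Y(u,z_0)v,z_2)$$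 holds, where $\delta(x)=\sum_{n\in\mathbb Z}x^n$ and powers of binomials are expanded in nonnegative powers of the second variable. $V$ is simple if $V\neq0$ and the only subspaces of $V$ invariant under all $v_n$ ($v\in V$, $n\in\mathbb Z$) are $0$ and $V$. An automorphism of $V$ is an invertible linear map $g$ with $gY(v,z)g^{-1}=Y(gv,z)$ for all $v\in V$, $g\mathbf 1=\mathbf 1$ and $g\omega=\omega$. A sub-VOA of $V$ is a graded subspace that contains $\mathbf 1$ and $\omega$ and is closed under all products $(u,w)\mapsto u_nw$, $n\in\mathbb Z$. **Proposition.** Let $V$ be a simple VOA and let $G$ be a finite group acting faithfully on $V$ by automorphisms. For a subgroup $H\le G$ put $V^H=\{v\in V: hv=v\text{ for all }h\in H\}$. Then, for every subgroup $H$ of $G$, $V^H$ is a sub-VOA of $V$ containing $V^G$, and the map $H\mapsto V^H$ from the set of subgroups of $G$ to the set of sub-VOAs of $V$ containing $V^G$ is injective. -/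

import Mathlib

/-- The component operators `u_n` of a state-field correspondence `u ↦ Y(u, z)`, where
`Y(u, z) = ∑ u_n z ^ (-n - 1)`. As a `VertexOperator` sends `w` to a Laurent series in `z`,
one has `u_n w = 0` for `n` sufficiently large (depending on `u` and `w`). -/
noncomputable def vertexMode {V : Type*} [AddCommGroup V] [Module ℂ V]
    (Y : V →ₗ[ℂ] VertexOperator ℂ V) (u : V) (n : ℤ) : Module.End ℂ V :=
  VertexOperator.ncoeff (Y u) n

/-- A vertex operator algebra structure on the complex vector space `V`. -/
class VertexOperatorAlgebra (V : Type*) [AddCommGroup V] [Module ℂ V] where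
  /-- The homogeneous subspaces `V_n`. -/
  gr : ℤ → Submodule ℂ V
  /-- The state-field correspondence `v ↦ Y(v, z)`. -/
  Y : V →ₗ[ℂ] VertexOperator ℂ V
  /-- The vacuum vector `𝟏`. -/
  vacuum : V
  /-- The Virasoro element `ω`. -/
  omega : V
  /-- The central charge. -/
  c : ℚ
  /-- `V` is the direct sum of the `V_n`. -/
  isInternal : DirectSum.IsInternal gr
  finite_gr : ∀ n : ℤ, FiniteDimensional ℂ (gr n)
  /-- `V_n = 0` for `n` sufficiently small. -/
  gr_eq_bot : ∃ N : ℤ, ∀ n < N, gr n = ⊥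
  vacuum_mem : vacuum ∈ gr 0
  omega_mem : omega ∈ gr 2
  Y_injective : Function.Injective Y
  /-- `Y(𝟏, z) = id`. -/
  vacuum_mode : ∀ (n : ℤ) (v : V), vertexMode Y vacuum n v = if n = -1 then v else 0
  /-- `Y(v, z) 𝟏` is a power series in `z`. -/
  mode_vacuum_of_nonneg : ∀ (v : V) (n : ℤ), 0 ≤ n → vertexMode Y v n vacuum = 0
  /-- `Y(v, z) 𝟏` has constant term `v`. -/
  mode_vacuum_neg_one : ∀ v : V, vertexMode Y v (-1) vacuum = v
  /-- The operators `L_n = ω_{n+1}` satisfy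
  `[L_m, L_n] = (m - n) L_{m+n} + δ_{m+n,0} (m³ - m) / 12 · c`. -/
  virasoro : ∀ (m n : ℤ) (v : V),
    vertexMode Y omega (m + 1) (vertexMode Y omega (n + 1) v)
      - vertexMode Y omega (n + 1) (vertexMode Y omega (m + 1) v)
    = ((m : ℂ) - (n : ℂ)) • vertexMode Y omega (m + n + 1) v
      + (if m + n = 0 then ((m : ℂ) ^ 3 - (m : ℂ)) / 12 * (c : ℂ) else 0) • v
  /-- `L_0` acts on `V_n` as multiplication by `n`. -/
  L_zero : ∀ (n : ℤ), ∀ v ∈ gr n, vertexMode Y omega 1 v = (n : ℂ) • v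
  /-- `d/dz Y(v, z) = Y(L_{-1} v, z)`. -/
  derivative : ∀ (v : V) (n : ℤ) (w : V),
    vertexMode Y (vertexMode Y omega 0 v) n w = -(n : ℂ) • vertexMode Y v (n - 1) w
  /-- The Jacobi identity
  `z₀⁻¹ δ((z₁ - z₂) / z₀) Y(u, z₁) Y(v, z₂) - z₀⁻¹ δ((z₂ - z₁) / (-z₀)) Y(v, z₂) Y(u, z₁)
    = z₂⁻¹ δ((z₁ - z₀) / z₂) Y(Y(u, z₀) v, z₂)`,
  as the equality of the coefficients of `z₀ ^ (-l-1) z₁ ^ (-m-1) z₂ ^ (-n-1)`, applied to `w`.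
  In each sum all but finitely many terms vanish. -/
  jacobi : ∀ (u v w : V) (l m n : ℤ),
    (∑ᶠ i : ℕ, ((-1 : ℤ) ^ i * Ring.choose l i) •
        vertexMode Y u (m + l - i) (vertexMode Y v (n + i) w))
      - (l.negOnePow : ℤ) • (∑ᶠ i : ℕ, ((-1 : ℤ) ^ i * Ring.choose l i) •
        vertexMode Y v (n + l - i) (vertexMode Y u (m + i) w))
    = ∑ᶠ i : ℕ, Ring.choose m i •
        vertexMode Y (vertexMode Y u (l + i) v) (m + n - i) w

namespace VertexOperatorAlgebra

/-- The component operator `u_n` of `Y(u, z) = ∑ u_n z ^ (-n - 1)`. -/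
noncomputable def mode {V : Type*} [AddCommGroup V] [Module ℂ V] [VertexOperatorAlgebra V]
    (u : V) (n : ℤ) : Module.End ℂ V :=
  vertexMode Y u n

/-- `V` is simple: it is nonzero, and its only subspaces invariant under all operators `v_n`
are `0` and `V`. -/
structure IsSimple (V : Type*) [AddCommGroup V] [Module ℂ V] [VertexOperatorAlgebra V] :
    Prop where
  nontrivial : Nontrivial V
  eq_bot_or_eq_top : ∀ W : Submodule ℂ V,
    (∀ (v : V) (n : ℤ), ∀ w ∈ W, mode v n w ∈ W) → W = ⊥ ∨ W = ⊤

/-- The group of automorphisms of the vertex operator algebra `V`: the invertible linear maps `g`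
with `g Y(v, z) g⁻¹ = Y(g v, z)` for all `v`, `g 𝟏 = 𝟏` and `g ω = ω`. -/
def autGroup (V : Type*) [AddCommGroup V] [Module ℂ V] [VertexOperatorAlgebra V] :
    Subgroup (V ≃ₗ[ℂ] V) where
  carrier := {g | (∀ (v : V) (n : ℤ) (w : V), g (mode v n w) = mode (g v) n (g w)) ∧
    g vacuum = vacuum ∧ g omega = omega}
  mul_mem' := by
    rintro a b ⟨ha, ha1, ha2⟩ ⟨hb, hb1, hb2⟩
    refine ⟨fun v n w => ?_, ?_, ?_⟩
    · simp only [LinearEquiv.mul_apply, hb, ha]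
    · simp only [LinearEquiv.mul_apply, hb1, ha1]
    · simp only [LinearEquiv.mul_apply, hb2, ha2]
  one_mem' := ⟨fun _ _ _ => rfl, rfl, rfl⟩
  inv_mem' := by
    rintro a ⟨ha, ha1, ha2⟩
    have key : ∀ x : V, a (a⁻¹ x) = x := fun x => a.apply_symm_apply x
    refine ⟨fun v n w => a.injective ?_, a.injective ?_, a.injective ?_⟩
    · rw [ha]; simp only [key]
    · rw [key, ha1]
    · rw [key, ha2]

/-- A sub vertex operator algebra of `V`: a graded subspace that contains the vacuum and the
Virasoro element of `V` and is closed under all products `u_n w`. The restricted operations make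
it a vertex operator algebra with the same vacuum and the same Virasoro element. -/
structure IsSubVOA {V : Type*} [AddCommGroup V] [Module ℂ V] [VertexOperatorAlgebra V]
    (W : Submodule ℂ V) : Prop where
  graded : W ≤ ⨆ n : ℤ, W ⊓ gr n
  vacuum_mem : vacuum ∈ W
  omega_mem : omega ∈ W
  mode_mem : ∀ u ∈ W, ∀ (n : ℤ), ∀ w ∈ W, mode u n w ∈ W

/-- The subspace `V^H` of vectors fixed by a subgroup `H` of a group `G` that acts on `V` by
automorphisms through `ρ`. -/
def fixedSubspace {V : Type*} [AddCommGroup V] [Module ℂ V] [VertexOperatorAlgebra V]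
    {G : Type*} [Group G] (ρ : G →* autGroup V) (H : Subgroup G) : Submodule ℂ V where
  carrier := {v | ∀ h ∈ H, (ρ h : V ≃ₗ[ℂ] V) v = v}
  add_mem' := by
    intro a b ha hb h hh
    rw [map_add, ha h hh, hb h hh]
  zero_mem' := fun _ _ => map_zero _
  smul_mem' := by
    intro r a ha h hh
    rw [map_smul, ha h hh]

end VertexOperatorAlgebra

/-!
The fixed subspace `V ^ H` is a sub-VOA because automorphisms respect all products and commute with
`L₀`, hence with the projections to the homogeneous subspaces.

Injectivity of `H ↦ V ^ H` follows the pattern of Artin's proof in classical Galois theory: distinct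
automorphisms of a simple vertex operator algebra are linearly independent over `ℂ`
(`linearIndependent_autGroup`). If `V ^ H = V ^ K` and `h ∈ H`, then `h` fixes every average
`∑ k ∈ K, k v`, so the operators `∑ k ∈ K, h k` and `∑ k ∈ K, k` agree, and comparing the
coefficients of `h` gives `h ∈ K`.

For the independence, Dedekind's argument applies an automorphism relation to a product `u_n v`. In
a field one then cancels; here the replacement for the absence of zero divisors is the injectivity
of `Y` on `V ⊗ V`, in the form: if `∑ i, Y(u i, z) (v i) = 0`, then `∑ i, f (v i) • u i = 0` for
every linear functional `f` (`sum_smul_eq_zero_of_sum_mode_eq_zero`). To see this, weak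
commutativity shows that the hypothesis survives replacing every `v i` by `x (v i)`, for any `x` in
the algebra generated by the modes (`sum_mode_mode_eq_zero`). By simplicity and Schur's lemma the
commutant of that algebra consists of the scalars (`exists_eq_smul_of_commute_mode`), so by
Jacobson's density theorem `x` can be chosen with `x (v i) = f (v i) • 𝟏`, and
`(u i)₋₁ 𝟏 = u i`.
-/

namespace VertexOperatorAlgebra

open Module

variable {V : Type*} [AddCommGroup V] [Module ℂ V] [VertexOperatorAlgebra V]

/-! ### The grading and `L₀` -/

/-- The homogeneous subspaces are the full eigenspaces of `L₀`. -/
theorem mem_gr_iff (n : ℤ) (v : V) : v ∈ gr n ↔ mode (omega : V) 1 v = (n : ℂ) • v := by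
  classical
  refine ⟨L_zero n v, fun hv => ?_⟩
  let _ := (isInternal (V := V)).chooseDecomposition
  have comp (m : ℤ) (w : V) :
      (DirectSum.decompose gr (mode (omega : V) 1 w) m : V)
        = (m : ℂ) • (DirectSum.decompose gr w m : V) := by
    induction w using DirectSum.Decomposition.inductionOn (ℳ := gr (V := V)) with
    | zero => simp
    | @homogeneous i w =>
      rw [show mode (omega : V) 1 (w : V) = (i : ℂ) • (w : V) from L_zero i _ w.2,
        DirectSum.decompose_smul, DirectSum.smul_apply, Submodule.coe_smul]
      by_cases h : i = m
      · subst h; rfl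
      · rw [DirectSum.decompose_of_mem_ne gr w.2 h, smul_zero, smul_zero]
    | add a b ha hb =>
      rw [map_add, DirectSum.decompose_add, DirectSum.decompose_add, DirectSum.add_apply,
        DirectSum.add_apply, Submodule.coe_add, Submodule.coe_add, ha, hb, smul_add]
  have hne (m : ℤ) (hm : m ≠ n) : (DirectSum.decompose gr v m : V) = 0 := by
    have h := comp m v
    rw [hv, DirectSum.decompose_smul, DirectSum.smul_apply, Submodule.coe_smul, ← sub_eq_zero,
      ← sub_smul, smul_eq_zero, sub_eq_zero, Int.cast_inj] at h
    exact h.resolve_left (Ne.symm hm)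
  rw [← DirectSum.sum_support_decompose gr v]
  refine Submodule.sum_mem _ fun m _ => ?_
  by_cases hm : m = n
  · exact hm ▸ SetLike.coe_mem _
  · rw [hne m hm]
    exact Submodule.zero_mem _

/-- The fixed subspace is graded: an automorphism fixes `ω`, hence commutes with `L₀` and with the
projections to its eigenspaces. -/
theorem isSubVOA_fixedSubspace {G : Type*} [Group G] (ρ : G →* autGroup V) (H : Subgroup G) :
    IsSubVOA (fixedSubspace ρ H) where
  graded := by
    classical
    let _ := (isInternal (V := V)).chooseDecomposition
    have hgr (g : autGroup V) (m : ℤ) (w : V) (hw : w ∈ gr m) : (g : V ≃ₗ[ℂ] V) w ∈ gr m := by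
      rw [mem_gr_iff] at hw ⊢
      have h := g.2.1 omega 1 w
      rw [g.2.2.2, hw, map_smul] at h
      exact h.symm
    have hcomp (g : autGroup V) (m : ℤ) (w : V) :
        (DirectSum.decompose gr ((g : V ≃ₗ[ℂ] V) w) m : V)
          = (g : V ≃ₗ[ℂ] V) (DirectSum.decompose gr w m : V) := by
      induction w using DirectSum.Decomposition.inductionOn (ℳ := gr (V := V)) with
      | zero => simp
      | @homogeneous i w =>
        by_cases h : i = m
        · subst h
          rw [DirectSum.decompose_of_mem_same gr (hgr g i w w.2),
            DirectSum.decompose_of_mem_same gr w.2]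
        · rw [DirectSum.decompose_of_mem_ne gr (hgr g i w w.2) h,
            DirectSum.decompose_of_mem_ne gr w.2 h, map_zero]
      | add a b ha hb =>
        rw [map_add, DirectSum.decompose_add, DirectSum.decompose_add, DirectSum.add_apply,
          DirectSum.add_apply, Submodule.coe_add, Submodule.coe_add, ha, hb, map_add]
    intro v hv
    rw [← DirectSum.sum_support_decompose gr v]
    refine Submodule.sum_mem _ fun m _ => Submodule.mem_iSup_of_mem m ⟨fun h hh => ?_, ?_⟩
    · rw [← hcomp, hv h hh]
    · exact SetLike.coe_mem _
  vacuum_mem h _ := (ρ h).2.2.1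
  omega_mem h _ := (ρ h).2.2.2
  mode_mem u hu n w hw h hh := by
    rw [(ρ h).2.1, hu h hh, hw h hh]

/-! ### Schur's lemma and density -/

theorem IsSimple.vacuum_ne_zero (hV : IsSimple V) : (vacuum : V) ≠ 0 := by
  intro h
  have := hV.nontrivial
  obtain ⟨v, hv⟩ := exists_ne (0 : V)
  apply hv
  rw [← mode_vacuum_neg_one v, h, map_zero]

/-- Schur's lemma. An operator commuting with all modes preserves the finite-dimensional `L₀`-
eigenspace `V₀ ∋ 𝟏`, so it has an eigenvalue there, and the eigenspace is invariant. -/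
theorem exists_eq_smul_of_commute_mode (hV : IsSimple V) (φ : V →ₗ[ℂ] V)
    (hφ : ∀ (u : V) (n : ℤ) (v : V), φ (mode u n v) = mode u n (φ v)) :
    ∃ μ : ℂ, ∀ v, φ v = μ • v := by
  have hmaps : ∀ v ∈ gr (V := V) 0, φ v ∈ gr (V := V) 0 := by
    intro v hv
    rw [mem_gr_iff] at hv ⊢
    rw [← hφ, hv, map_smul]
  have := finite_gr (V := V) 0
  have : Nontrivial (gr (V := V) 0) :=
    ⟨⟨vacuum, vacuum_mem⟩, 0, fun h => hV.vacuum_ne_zero congr(($h : V))⟩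
  obtain ⟨μ, hμ⟩ := Module.End.exists_eigenvalue (φ.restrict hmaps)
  obtain ⟨w, hw⟩ := hμ.exists_hasEigenvector
  have hw' : φ w = μ • (w : V) := congr(($(hw.apply_eq_smul) : V))
  refine ⟨μ, ?_⟩
  rcases hV.eq_bot_or_eq_top (LinearMap.ker (φ - μ • LinearMap.id)) (by
    intro u n v hv
    simp only [LinearMap.mem_ker, LinearMap.sub_apply, LinearMap.smul_apply, LinearMap.id_apply,
      sub_eq_zero] at hv ⊢
    rw [hφ, hv, map_smul]) with h | h
  · exfalso
    have : (w : V) ∈ LinearMap.ker (φ - μ • LinearMap.id) := by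
      simp [hw']
    rw [h, Submodule.mem_bot] at this
    exact hw.2 (Subtype.ext this)
  · intro v
    have : v ∈ LinearMap.ker (φ - μ • LinearMap.id) := h ▸ Submodule.mem_top
    simpa [sub_eq_zero] using this

variable (V) in
/-- The associative algebra of operators on `V` generated by all modes `u_n`. -/
noncomputable def modeAlgebra : Subalgebra ℂ (Module.End ℂ V) :=
  Algebra.adjoin ℂ {x | ∃ (u : V) (n : ℤ), x = mode u n}

theorem mode_mem_modeAlgebra (u : V) (n : ℤ) : mode u n ∈ modeAlgebra V :=
  Algebra.subset_adjoin ⟨u, n, rfl⟩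

theorem isSimpleModule_modeAlgebra (hV : IsSimple V) : IsSimpleModule (modeAlgebra V) V := by
  have := hV.nontrivial
  rw [isSimpleModule_iff]
  refine { eq_bot_or_eq_top := fun W => ?_ }
  rcases hV.eq_bot_or_eq_top (W.restrictScalars ℂ)
    (fun u n w hw => W.smul_mem ⟨_, mode_mem_modeAlgebra u n⟩ hw) with h | h
  · exact Or.inl (by simpa using h)
  · exact Or.inr (by simpa using h)

/-- Density: on finitely many vectors, every linear operator on a simple vertex operator algebra
agrees with an element of the algebra generated by the modes. -/
theorem exists_mem_modeAlgebra_eq (hV : IsSimple V) (f : V →ₗ[ℂ] V) (s : Finset V) :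
    ∃ x ∈ modeAlgebra V, ∀ v ∈ s, f v = x v := by
  have := isSimpleModule_modeAlgebra hV
  let F : Module.End (Module.End (modeAlgebra V) V) V :=
    { toFun := f
      map_add' := map_add f
      map_smul' := by
        intro φ v
        obtain ⟨μ, hμ⟩ := exists_eq_smul_of_commute_mode hV (φ.restrictScalars ℂ)
          fun u n v => map_smul φ (⟨_, mode_mem_modeAlgebra u n⟩ : modeAlgebra V) v
        have hμ' : ∀ v, φ v = μ • v := hμ
        simp only [End.smul_def, RingHom.id_apply, hμ', map_smul] }
  obtain ⟨r, hr⟩ := jacobson_density F s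
  exact ⟨r, r.2, hr⟩

/-! ### Nondegeneracy of the state-field correspondence -/

theorem exists_mode_eq_zero (u v : V) : ∃ N : ℤ, ∀ n, N ≤ n → mode u n v = 0 := by
  refine ⟨-HahnSeries.order ((HahnModule.of ℂ).symm (Y u v)), fun n hn => ?_⟩
  exact VertexOperator.ncoeff_eq_zero_of_lt_order (Y u) n v (by lia)

/-- A bound valid for a finite family of vectors simultaneously. -/
theorem exists_nat_forall_mode_eq_zero {ι : Type*} (s : Finset ι) (f g : ι → V) :
    ∃ N : ℕ, ∀ i ∈ s, ∀ n : ℤ, N ≤ n → mode (f i) n (g i) = 0 := by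
  choose N hN using fun i => exists_mode_eq_zero (f i) (g i)
  refine ⟨s.sup fun i => (N i).toNat, fun i hi n hn => hN i n ?_⟩
  have := Finset.le_sup (f := fun i => (N i).toNat) hi
  lia

/-- Weak commutativity `(z₁ - z₂)ᴺ [Y(u, z₁), Y(v, z₂)] = 0`, coefficientwise. -/
theorem sum_choose_smul_mode_mode {u v : V} {N : ℕ} (hN : ∀ n : ℤ, N ≤ n → mode u n v = 0)
    (w : V) (m n : ℤ) :
    ∑ i ∈ Finset.range (N + 1), ((-1 : ℤ) ^ i * (N.choose i : ℤ)) •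
        mode u (m + N - i) (mode v (n + i) w)
      = ((N : ℤ).negOnePow : ℤ) • ∑ i ∈ Finset.range (N + 1), ((-1 : ℤ) ^ i * (N.choose i : ℤ)) •
        mode v (n + N - i) (mode u (m + i) w) := by
  have h := jacobi u v w N m n
  have hR : (∑ᶠ i : ℕ, Ring.choose m i •
      vertexMode Y (vertexMode Y u ((N : ℤ) + i) v) (m + n - i) w) = 0 := by
    rw [← finsum_zero (α := ℕ)]
    refine finsum_congr fun i => ?_
    rw [show vertexMode Y u ((N : ℤ) + i) v = 0 from hN _ (by lia)]
    simp [vertexMode]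
  have hfin (F : ℕ → V) : (∑ᶠ i : ℕ, ((-1 : ℤ) ^ i * Ring.choose (N : ℤ) i) • F i)
      = ∑ i ∈ Finset.range (N + 1), ((-1 : ℤ) ^ i * (N.choose i : ℤ)) • F i := by
    simp only [Ring.choose_natCast]
    refine finsum_eq_sum_of_support_subset _ fun i hi => ?_
    by_contra hc
    simp only [Finset.coe_range, Set.mem_Iio, not_lt] at hc
    exact hi (by simp [Nat.choose_eq_zero_of_lt (show N < i by lia)])
  rw [hR, sub_eq_zero, hfin, hfin] at h
  exact h

/-- The relation `∑ i, Y(u i, z) (v i) = 0` is preserved on applying a mode to all `v i`. -/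
theorem sum_mode_mode_eq_zero {ι : Type*} (s : Finset ι) (u v : ι → V)
    (h : ∀ n : ℤ, ∑ i ∈ s, mode (u i) n (v i) = 0) (a : V) (m n : ℤ) :
    ∑ i ∈ s, mode (u i) n (mode a m (v i)) = 0 := by
  obtain ⟨N, hN⟩ := exists_nat_forall_mode_eq_zero s (fun _ => a) u
  obtain ⟨M, hM⟩ := exists_nat_forall_mode_eq_zero s (fun _ => a) v
  have rel (m n : ℤ) : ∑ k ∈ Finset.range (N + 1), ((-1 : ℤ) ^ k * (N.choose k : ℤ)) •
      ∑ i ∈ s, mode (u i) (n + N - k) (mode a (m + k) (v i)) = 0 := by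
    have hL : ∑ i ∈ s, ∑ k ∈ Finset.range (N + 1), ((-1 : ℤ) ^ k * (N.choose k : ℤ)) •
        mode a (m + N - k) (mode (u i) (n + k) (v i)) = 0 := by
      rw [Finset.sum_comm]
      refine Finset.sum_eq_zero fun k _ => ?_
      rw [← Finset.smul_sum, ← map_sum, h, map_zero, smul_zero]
    rw [Finset.sum_congr rfl fun i hi => sum_choose_smul_mode_mode (hN i hi) (v i) m n,
      ← Finset.smul_sum, Finset.sum_comm] at hL
    simp only [← Finset.smul_sum] at hL
    rcases Int.units_eq_one_or (N : ℤ).negOnePow with hs | hs <;> simpa [hs] using hL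
  -- Cancel `(z₁ - z₂)ᴺ`: the series is bounded in `z₁`, so its coefficients vanish by descending
  -- induction on the mode `m = M - d` of `a`.
  suffices key : ∀ d : ℕ, ∀ m n : ℤ, (M : ℤ) - d ≤ m →
      ∑ i ∈ s, mode (u i) n (mode a m (v i)) = 0 from key ((M : ℤ) - m).toNat m n (by lia)
  intro d
  induction d with
  | zero =>
    intro m n hm
    refine Finset.sum_eq_zero fun i hi => ?_
    rw [hM i hi m (by lia), map_zero]
  | succ d ih =>
    intro m n hm
    have hr := rel m (n - N)
    rw [Finset.sum_range_succ', Finset.sum_eq_zero fun k _ => by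
      rw [ih (m + (k + 1 : ℕ)) _ (by push_cast at hm ⊢; lia), smul_zero]] at hr
    simpa using hr

/-- The relation `∑ i, Y(u i, z) (v i) = 0` is preserved by the algebra generated by the modes. -/
theorem sum_mode_apply_eq_zero_of_mem_modeAlgebra {ι : Type*} (s : Finset ι) (u v : ι → V)
    (h : ∀ n : ℤ, ∑ i ∈ s, mode (u i) n (v i) = 0) {x : Module.End ℂ V}
    (hx : x ∈ modeAlgebra V) (n : ℤ) : ∑ i ∈ s, mode (u i) n (x (v i)) = 0 := by
  induction hx using Algebra.adjoin_induction generalizing v n with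
  | mem x hx =>
    obtain ⟨a, m, rfl⟩ := hx
    exact sum_mode_mode_eq_zero s u v h a m n
  | algebraMap r =>
    simp only [Module.algebraMap_end_apply, map_smul, ← Finset.smul_sum, h, smul_zero]
  | add x y _ _ hx hy =>
    simp only [LinearMap.add_apply, map_add, Finset.sum_add_distrib, hx v h, hy v h, add_zero]
  | mul x y _ _ hx hy =>
    exact hx (fun i => y (v i)) (hy v h) n

/-- For simple `V`, the map `u ⊗ v ↦ Y(u, z) v` is injective on `V ⊗ V`; the conclusion says that
`∑ i, u i ⊗ v i` is killed by every `id ⊗ f`. -/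
theorem sum_smul_eq_zero_of_sum_mode_eq_zero (hV : IsSimple V) {ι : Type*} (s : Finset ι)
    (u v : ι → V) (h : ∀ n : ℤ, ∑ i ∈ s, mode (u i) n (v i) = 0) (f : Module.Dual ℂ V) :
    ∑ i ∈ s, f (v i) • u i = 0 := by
  classical
  obtain ⟨x, hx, hxv⟩ := exists_mem_modeAlgebra_eq hV (f.smulRight vacuum) (s.image v)
  rw [← sum_mode_apply_eq_zero_of_mem_modeAlgebra s u v h hx (-1)]
  refine Finset.sum_congr rfl fun i hi => ?_
  rw [← hxv _ (Finset.mem_image_of_mem v hi), LinearMap.smulRight_apply, map_smul]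
  exact congr(f (v i) • $(mode_vacuum_neg_one (u i))).symm

/-! ### Independence of automorphisms -/

/-- Dedekind's lemma: distinct automorphisms of a simple vertex operator algebra are linearly
independent. -/
theorem linearIndependent_autGroup (hV : IsSimple V) :
    LinearIndependent ℂ (fun g : autGroup V => ((g : V ≃ₗ[ℂ] V) : V →ₗ[ℂ] V)) := by
  classical
  rw [linearIndependent_iff']
  intro s
  induction s using Finset.induction_on with
  | empty => simp
  | insert g₀ s hg₀ ih =>
    intro a ha
    have hrel (v : V) : ∑ g ∈ insert g₀ s, a g • (g : V ≃ₗ[ℂ] V) v = 0 := by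
      simpa using congr($ha v)
    -- Apply the relation to `u_n v`, contract with `f`, and subtract `f (g₀ v)` times the relation
    -- at `u` to eliminate `g₀`.
    have hshort (f : Module.Dual ℂ V) (v u : V) :
        ∑ g ∈ s, (a g * (f ((g : V ≃ₗ[ℂ] V) v) - f ((g₀ : V ≃ₗ[ℂ] V) v))) •
          (g : V ≃ₗ[ℂ] V) u = 0 := by
      have h1 := sum_smul_eq_zero_of_sum_mode_eq_zero hV (insert g₀ s)
        (fun g => (g : V ≃ₗ[ℂ] V) u) (fun g => a g • (g : V ≃ₗ[ℂ] V) v)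
        (fun n => by
          rw [← hrel (mode u n v)]
          refine Finset.sum_congr rfl fun g _ => ?_
          rw [map_smul, g.2.1]) f
      have h2 := congr($h1 - f ((g₀ : V ≃ₗ[ℂ] V) v) • $(hrel u))
      rw [Finset.smul_sum, ← Finset.sum_sub_distrib, Finset.sum_insert hg₀, smul_zero,
        sub_zero] at h2
      rw [← h2, map_smul, smul_eq_mul, smul_smul, mul_comm, sub_self, zero_add]
      refine Finset.sum_congr rfl fun g _ => ?_
      rw [map_smul, smul_eq_mul, smul_smul, ← sub_smul, mul_sub, mul_comm (a g) (f (_))]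
      congr 2
      ring
    have has : ∀ g ∈ s, a g = 0 := by
      intro g hg
      by_contra hne
      apply hg₀
      suffices h : g = g₀ from h ▸ hg
      refine Subtype.ext (LinearEquiv.ext fun v => ?_)
      rw [← sub_eq_zero, ← Module.forall_dual_apply_eq_zero_iff ℂ]
      intro f
      have := ih (fun g => a g * (f ((g : V ≃ₗ[ℂ] V) v) - f ((g₀ : V ≃ₗ[ℂ] V) v)))
        (LinearMap.ext fun u => by simpa using hshort f v u) g hg
      rw [map_sub]
      exact (mul_eq_zero.1 this).resolve_left hne
    intro g hg
    rcases Finset.mem_insert.1 hg with rfl | hg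
    · have h := hrel vacuum
      rw [Finset.sum_insert hg₀, Finset.sum_eq_zero fun g hg => by rw [has g hg, zero_smul],
        add_zero, g.2.2.1, smul_eq_zero] at h
      exact h.resolve_right hV.vacuum_ne_zero
    · exact has g hg

/-- An element of `H` outside `K` would send `∑ k ∈ K, k v ∈ V ^ K ⊆ V ^ H` to
`∑ k ∈ K, h k v`, which by independence differs from it for some `v`. -/
theorem le_of_fixedSubspace_le (hV : IsSimple V) {G : Type*} [Group G] [Finite G]
    (ρ : G →* autGroup V) (hρ : Function.Injective ρ) {H K : Subgroup G}
    (hle : fixedSubspace ρ K ≤ fixedSubspace ρ H) : H ≤ K := by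
  classical
  have := Fintype.ofFinite G
  intro h hh
  -- The group algebra element `∑ k ∈ K, k` and its action on `V`.
  let e : G → ℂ := fun g => if g ∈ K then 1 else 0
  let E : V → V := fun v => ∑ g, e g • (ρ g : V ≃ₗ[ℂ] V) v
  have htrans (x : G) (v : V) :
      (ρ x : V ≃ₗ[ℂ] V) (E v) = ∑ g, e (x⁻¹ * g) • (ρ g : V ≃ₗ[ℂ] V) v := by
    simp only [E, map_sum, map_smul]
    refine Fintype.sum_equiv (Equiv.mulLeft x) _ _ fun g => ?_
    simp [LinearEquiv.mul_apply]
  have hE (v : V) : E v ∈ fixedSubspace ρ K := by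
    intro k hk
    rw [htrans]
    refine Finset.sum_congr rfl fun g _ => ?_
    simp only [e, K.mul_mem_cancel_left (K.inv_mem hk)]
  have hind := Fintype.linearIndependent_iff.1
    ((linearIndependent_autGroup hV).comp ρ hρ) (fun g => e (h⁻¹ * g) - e g)
    (LinearMap.ext fun v => by
      have := hle (hE v) h hh
      rw [htrans, ← sub_eq_zero, ← Finset.sum_sub_distrib] at this
      simpa [sub_smul] using this) h
  by_contra hc
  simp [e, hc, K.one_mem] at hind

end VertexOperatorAlgebra

theorem proposition3p3 {V : Type*} [AddCommGroup V] [Module ℂ V] [VertexOperatorAlgebra V]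
    (hV : VertexOperatorAlgebra.IsSimple V)
    {G : Type*} [Group G] [Finite G]
    (ρ : G →* VertexOperatorAlgebra.autGroup V) (hρ : Function.Injective ρ) :
    (∀ H : Subgroup G,
      VertexOperatorAlgebra.IsSubVOA (VertexOperatorAlgebra.fixedSubspace ρ H) ∧
      VertexOperatorAlgebra.fixedSubspace ρ ⊤ ≤ VertexOperatorAlgebra.fixedSubspace ρ H) ∧
    Function.Injective
      (fun H : Subgroup G => VertexOperatorAlgebra.fixedSubspace ρ H) := by
  open VertexOperatorAlgebra in
  exact ⟨fun H => ⟨isSubVOA_fixedSubspace ρ H, fun _ hv h _ => hv h (Subgroup.mem_top h)⟩,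
    fun _ _ hHK => le_antisymm (le_of_fixedSubspace_le hV ρ hρ (ge_of_eq hHK))
      (le_of_fixedSubspace_le hV ρ hρ (le_of_eq hHK))⟩
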